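/- Let $K\ge 1$ and $1\le T\le N$ be integers. A $T$-private information retrieval (PIR) scheme with $K$ messages and $N$ replicated databases consists of the following. There are $K$ independent messages $W_1,\dots,W_K$ of $L$ bits each, with $H(W_1)=\dots=H(W_K)=L$ for some integer $L\ge 1$; every database stores all the messages. For each desired index $k\in\{1,\dots,K\}$ the user generates random queries $Q_1^{[k]},\dots,Q_N^{[k]}$ that are jointly independent of $(W_1,\dots,W_K)$ and sends $Q_n^{[k]}$ to database $n$, which returns an answer $A_n^{[k]}$ that is a deterministic function (not depending on $k$) of $Q_n^{[k]}$ and $W_1,\dots,W_K$. It is required that - (correctness) $W_k$ is almost surely a function of $A_1^{[k]},\dots,A_N^{[k]},Q_1^{[k]},\dots,Q_N^{[k]}$, for every $k$; - ($T$-privacy) for every $\mathcal T\subset\{1,\dots,N\}$ with $|\mathcal T|=T$, the joint law of $(Q_n^{[k]})_{n\in\mathcal T}$ does not depend on $k$. By privacy, $H(A_n^{[k]})$ does not depend on $k$; write it $H(A_n)$ (in bits). The rate of the scheme is $R=L\big/\sum_{n=1}^N H(A_n)$, the number of desired bits retrieved per downloaded bit, and the capacity $C$ is the supremum of $R$ over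 all such schemes (and all $L$). **Theorem.** The capacity of $T$-private PIR with $K$ messages and $N$ databases is $$C=\left(1+\frac{T}{N}+\frac{T^2}{N^2}+\cdots+\frac{T^{K-1}}{N^{K-1}}\right)^{-1}.$$ -/

import Mathlib

open MeasureTheory ProbabilityTheory
open scoped ENNReal

namespace PIR

/-- Shannon entropy, in bits, of a discrete (countably valued) random variable `X`,
as an extended nonnegative real. -/
noncomputable def entropy {Ω S : Type} [MeasurableSpace Ω] (μ : Measure Ω) (X : Ω → S) : ℝ≥0∞ :=
  ∑' s, ENNReal.ofReal (Real.negMulLog (μ.real (X ⁻¹' {s})) / Real.log 2)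

/-- The messages: `K` strings of `L` bits each. -/
abbrev Messages (K L : ℕ) : Type := Fin K → Fin L → Bool

/-- A zero-error `T`-private information retrieval scheme with `K` messages and `N` replicated
databases. The alphabet `Query` of the queries is an arbitrary measurable space and the alphabet
`Answer` of the answers is countable and discrete; databases with different alphabets are covered
by taking disjoint unions. -/
structure Scheme (K N T : ℕ) where
  /-- The message size in bits. -/
  L : ℕ
  L_pos : 0 < L
  /-- The underlying probability space. -/
  Ω : Type
  [measurableSpaceΩ : MeasurableSpace Ω]
  μ : Measure Ω
  [isProbabilityMeasure : IsProbabilityMeasure μ]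
  /-- The messages. -/
  W : Fin K → Ω → (Fin L → Bool)
  measurable_W : ∀ k, Measurable (W k)
  indep_W : iIndepFun W μ
  entropy_W : ∀ k, entropy μ (W k) = L
  /-- The alphabet of the queries. -/
  Query : Type
  [measurableSpaceQuery : MeasurableSpace Query]
  /-- `Q k ω n` is the query sent to database `n` when message `k` is desired. -/
  Q : Fin K → Ω → Fin N → Query
  measurable_Q : ∀ k, Measurable (Q k)
  /-- The queries are independent of the messages. -/
  indep_Q : ∀ k, IndepFun (fun ω i => W i ω : Ω → Messages K L) (Q k) μ
  /-- The alphabet of the answers. -/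
  Answer : Type
  [measurableSpaceAnswer : MeasurableSpace Answer]
  [countableAnswer : Countable Answer]
  [measurableSingletonClassAnswer : MeasurableSingletonClass Answer]
  /-- The answer of database `n` is a deterministic function of the query that it receives and of
  all the messages. The database does not know which message is desired. -/
  answer : Fin N → Query → Messages K L → Answer
  measurable_answer : ∀ n, Measurable (Function.uncurry (answer n))
  /-- The decoder of the user when message `k` is desired. -/
  decode : Fin K → (Fin N → Answer) → (Fin N → Query) → (Fin L → Bool)
  measurable_decode : ∀ k, Measurable (Function.uncurry (decode k))
  /-- Correctness: the desired message is determined by the answers and the queries. -/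
  correct : ∀ k, ∀ᵐ ω ∂μ,
    decode k (fun n => answer n (Q k ω n) (fun i => W i ω)) (Q k ω) = W k ω
  /-- `T`-privacy: the joint law of the queries to any `T` databases does not depend on the index
  of the desired message. -/
  privacy : ∀ 𝒯 : Finset (Fin N), 𝒯.card = T → ∀ k k' : Fin K,
    IdentDistrib (fun ω (n : 𝒯) => Q k ω n) (fun ω (n : 𝒯) => Q k' ω n) μ μ

attribute [instance] Scheme.measurableSpaceΩ Scheme.isProbabilityMeasure
  Scheme.measurableSpaceQuery Scheme.measurableSpaceAnswer Scheme.countableAnswer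
  Scheme.measurableSingletonClassAnswer

namespace Scheme

variable {K N T : ℕ} (S : Scheme K N T)

/-- The answer of database `n` when message `k` is desired, as a random variable. -/
def A (k : Fin K) (n : Fin N) (ω : S.Ω) : S.Answer :=
  S.answer n (S.Q k ω n) (fun i => S.W i ω)

/-- The total download in bits when message `k` is desired. -/
noncomputable def download (k : Fin K) : ℝ≥0∞ := ∑ n, entropy S.μ (S.A k n)

/-- The rate: desired bits per downloaded bit. The download is the same for every desired message
(see `download_eq`), so that the supremum over `k` is just this common value. -/
noncomputable def rate : ℝ≥0∞ := (S.L : ℝ≥0∞) / ⨆ k, S.download k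

theorem download_eq (hT : 1 ≤ T) (hTN : T ≤ N) (k k' : Fin K) :
    S.download k = S.download k' := by
  unfold download
  refine Finset.sum_congr rfl fun n _ => ?_
  obtain ⟨t, hnt, htc⟩ := Finset.exists_superset_card_eq (s := {n}) (n := T)
    (by simpa using hT) (by simpa using hTN)
  have hn : n ∈ t := hnt (Finset.mem_singleton_self n)
  have hQ : IdentDistrib (fun ω => S.Q k ω n) (fun ω => S.Q k' ω n) S.μ S.μ :=
    (S.privacy t htc k k').comp (measurable_pi_apply (⟨n, hn⟩ : t))
  have hW : Measurable (fun ω i => S.W i ω : S.Ω → Messages K S.L) :=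
    measurable_pi_lambda _ S.measurable_W
  have hi : ∀ j, IndepFun (fun ω => S.Q j ω n) (fun ω i => S.W i ω : S.Ω → Messages K S.L) S.μ :=
    fun j => ((S.indep_Q j).comp measurable_id (measurable_pi_apply n)).symm
  have hA : IdentDistrib (S.A k n) (S.A k' n) S.μ S.μ :=
    (hQ.prodMk (IdentDistrib.refl hW.aemeasurable) (hi k) (hi k')).comp (S.measurable_answer n)
  unfold entropy
  refine tsum_congr fun s => ?_
  simp only [Measure.real, hA.measure_mem_eq (measurableSet_singleton s)]

end Scheme

/-- The capacity: the supremum of the rates of all schemes, over all message sizes. -/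
noncomputable def capacity (K N T : ℕ) : ℝ≥0∞ := ⨆ S : Scheme K N T, S.rate

end PIR

/-! Converse. Prescribed entropy makes the messages uniform, and queries are independent of them, so
for fixed queries everything is a function on the finite set of message tuples and its entropy is a
count of fibres; conditional entropies are averages over the queries. Let `x k` be the entropy of
all answers for desired message `k`, given the queries and the messages before `k`. Correctness lets
message `k` be added for free, which contributes `L * log 2` (`meanViewEntropy_succ`,
`prefixEntropy_succ`). What remains is at least the entropy of any `T` answers; by privacy these may
be taken from the scheme for message `k + 1`, and Han's inequality averaged over cyclic intervals
gives a fraction `T / N` of `x (k + 1)` (`mul_meanViewEntropy_le`). Hence `x k ≥ L * log 2 + (T / N)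
* x (k + 1)`, which unrolls to the geometric sum. The download bounds `x 0` from above, since
conditioning reduces entropy and entropy is subadditive.

Achievability for `T < N`. Slots are indexed by `σ : Fin K → Fin N`, and message `i` takes part in a
slot exactly when `T ≤ σ i`. Each database returns one sum over the messages per slot. Along
direction `k` the undesired messages form codewords of a Reed–Solomon code with `N * N` positions
and dimension `N * T`, whose systematic positions are those with `σ k < T`. The desired message is
absent there, so the user reads off pure interference, extrapolates it and subtracts it
(`sum_encode_sub`). Any `T` databases hold an information set of the code, so coded and uncoded
symbols look alike to them after a random bijection of each message (`exists_perm_encode_eq`). A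
message has `(N - T) * N ^ K` symbols and the download is `N * (N ^ K - T ^ K)` symbols, which is
the claimed ratio. For `T = N`, downloading everything suffices. -/

namespace PIR

/-! ### Entropy of functions on a finite uniform space -/

section FiniteEntropy

variable {α β γ δ : Type*} [Fintype α]

open Classical in
/-- The number of points of a finite type in the fiber of `f` through `a`. -/
noncomputable def fiberCard (f : α → β) (a : α) : ℕ := (Finset.univ.filter fun b => f b = f a).card

/-- The entropy, in nats, of a function on a finite type with the uniform distribution. -/
noncomputable def unifEntropy (f : α → β) : ℝ :=
  Real.log (Fintype.card α) - (∑ a, Real.log (fiberCard f a)) / Fintype.card α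

theorem fiberCard_pos (f : α → β) (a : α) : 0 < fiberCard f a := by
  classical
  unfold fiberCard
  exact Finset.card_pos.2 ⟨a, by simp⟩

theorem fiberCard_le_of_ker_le {f : α → β} {g : α → γ} (h : ∀ a b, f a = f b → g a = g b) (a : α) :
    fiberCard f a ≤ fiberCard g a := by
  classical
  unfold fiberCard
  exact Finset.card_le_card fun b hb => by simpa using h b a (by simpa using hb)

/-- A finer partition has smaller fibres. Entropy thus depends only on the kernel of the function,
and the alphabet never matters. -/
theorem unifEntropy_le_of_ker_le {f : α → β} {g : α → γ} (h : ∀ a b, f a = f b → g a = g b) :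
    unifEntropy g ≤ unifEntropy f := by
  unfold unifEntropy
  have : ∑ a, Real.log (fiberCard f a) ≤ ∑ a, Real.log (fiberCard g a) :=
    Finset.sum_le_sum fun a _ => Real.log_le_log (by exact_mod_cast fiberCard_pos f a)
      (by exact_mod_cast fiberCard_le_of_ker_le h a)
  gcongr

theorem unifEntropy_congr {f : α → β} {g : α → γ} (h : ∀ a b, f a = f b ↔ g a = g b) :
    unifEntropy f = unifEntropy g :=
  le_antisymm (unifEntropy_le_of_ker_le fun a b => (h a b).2)
    (unifEntropy_le_of_ker_le fun a b => (h a b).1)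

theorem unifEntropy_le_log_card (f : α → β) : unifEntropy f ≤ Real.log (Fintype.card α) := by
  unfold unifEntropy
  have : 0 ≤ ∑ a, Real.log (fiberCard f a) :=
    Finset.sum_nonneg fun a _ => Real.log_nonneg (by exact_mod_cast fiberCard_pos f a)
  have := div_nonneg this (Nat.cast_nonneg (Fintype.card α))
  linarith

theorem unifEntropy_nonneg [Nonempty α] (f : α → β) : 0 ≤ unifEntropy f := by
  have h := unifEntropy_le_of_ker_le (f := f) (g := fun _ : α => ()) fun _ _ _ => rfl
  refine le_trans (le_of_eq ?_) h
  simp [unifEntropy, fiberCard]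

/-- The numerator counts pairs `(b, c)` with `b` in the `x`-fibre and `c` in the `y`-fibre of `a`.
After exchanging sums, each pair is served by at most one joint fibre, and both its points lie in
one `z`-fibre. -/
theorem sum_fiberCard_ratio_le {x : α → β} {y : α → γ} {z : α → δ}
    (hx : ∀ a b, x a = x b → z a = z b) (hy : ∀ a b, y a = y b → z a = z b) :
    ∑ a, ((fiberCard x a : ℝ) * fiberCard y a) /
      (fiberCard (fun a => (x a, y a)) a * fiberCard z a) ≤ Fintype.card α := by
  classical
  have hxc : ∀ a, (fiberCard x a : ℝ) = ∑ b, if x b = x a then (1 : ℝ) else 0 := fun a => by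
    simp [fiberCard]
  have hyc : ∀ a, (fiberCard y a : ℝ) = ∑ b, if y b = y a then (1 : ℝ) else 0 := fun a => by
    simp [fiberCard]
  have hzc : ∀ a, (fiberCard z a : ℝ) = ∑ b, if z b = z a then (1 : ℝ) else 0 := fun a => by
    simp [fiberCard]
  have hzp : ∀ a, (0 : ℝ) < fiberCard z a := fun a => by exact_mod_cast fiberCard_pos z a
  calc ∑ a, ((fiberCard x a : ℝ) * fiberCard y a) /
        (fiberCard (fun a => (x a, y a)) a * fiberCard z a)
      = ∑ a, ∑ b, ∑ c, (if x b = x a then (1 : ℝ) else 0) * (if y c = y a then (1 : ℝ) else 0) /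
          (fiberCard (fun a => (x a, y a)) a * fiberCard z a) := by
        refine Finset.sum_congr rfl fun a _ => ?_
        rw [hxc, hyc, Finset.sum_mul_sum, Finset.sum_div]
        exact Finset.sum_congr rfl fun b _ => by rw [Finset.sum_div]
    _ = ∑ b, ∑ c, ∑ a, (if x b = x a then (1 : ℝ) else 0) * (if y c = y a then (1 : ℝ) else 0) /
          (fiberCard (fun a => (x a, y a)) a * fiberCard z a) := by
        rw [Finset.sum_comm]
        exact Finset.sum_congr rfl fun b _ => Finset.sum_comm
    _ ≤ ∑ b, ∑ c, (if z c = z b then (1 : ℝ) else 0) / fiberCard z b := by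
        refine Finset.sum_le_sum fun b _ => Finset.sum_le_sum fun c _ => ?_
        -- If some `a₀` serves the pair, the indices that contribute are exactly the joint fibre of
        -- `a₀`, on which the summand is constant, so the inner sum equals `1 / fiberCard z b`.
        -- Otherwise it is zero.
        by_cases hne : ∃ a₀, x b = x a₀ ∧ y c = y a₀
        · obtain ⟨a₀, hb, hc⟩ := hne
          have hzb : z b = z a₀ := hx _ _ hb
          have hzc' : z c = z a₀ := hy _ _ hc
          rw [if_pos (hzc'.trans hzb.symm)]
          have hterm : ∀ a, (if x b = x a then (1 : ℝ) else 0) * (if y c = y a then (1 : ℝ) else 0) /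
              (fiberCard (fun a => (x a, y a)) a * fiberCard z a) =
              (if (x a, y a) = (x a₀, y a₀) then (1 : ℝ) else 0) *
                (1 / (fiberCard (fun a => (x a, y a)) a₀ * fiberCard z b)) := by
            intro a
            by_cases h1 : x a = x a₀ <;> by_cases h2 : y a = y a₀
            · have e1 : fiberCard (fun a => (x a, y a)) a = fiberCard (fun a => (x a, y a)) a₀ := by
                simp [fiberCard, h1, h2]
              have e2 : fiberCard z a = fiberCard z b := by
                simp only [fiberCard, hzb, hx _ _ h1]
              simp [hb, hc, h1, h2, e1, e2]
            · simp [hb, hc, h1, h2, Ne.symm h2]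
            · simp [hb, hc, h1, h2, Ne.symm h1]
            · simp [hb, hc, h1, h2, Ne.symm h1]
          rw [Finset.sum_congr rfl fun a _ => hterm a, ← Finset.sum_mul]
          have : (∑ a, if (x a, y a) = (x a₀, y a₀) then (1 : ℝ) else 0) =
              fiberCard (fun a => (x a, y a)) a₀ := by simp [fiberCard]
          rw [this]
          have hp : (0 : ℝ) < fiberCard (fun a => (x a, y a)) a₀ := by
            exact_mod_cast fiberCard_pos _ _
          have := hzp b
          apply le_of_eq
          field_simp
        · push Not at hne
          rw [Finset.sum_eq_zero]
          · split_ifs <;> positivity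
          · intro a _
            by_cases h1 : x b = x a
            · simp [hne a h1]
            · simp [h1]
    _ = ∑ b : α, (1 : ℝ) := by
        refine Finset.sum_congr rfl fun b _ => ?_
        rw [← Finset.sum_div, ← hzc, div_self (hzp b).ne']
    _ = Fintype.card α := by simp

/-- Submodularity of entropy: conditional mutual information is nonnegative. -/
theorem unifEntropy_prod_add_le {x : α → β} {y : α → γ} {z : α → δ}
    (hx : ∀ a b, x a = x b → z a = z b) (hy : ∀ a b, y a = y b → z a = z b) :
    unifEntropy (fun a => (x a, y a)) + unifEntropy z ≤ unifEntropy x + unifEntropy y := by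
  have hxp : ∀ a, (0 : ℝ) < fiberCard x a := fun a => by exact_mod_cast fiberCard_pos x a
  have hyp : ∀ a, (0 : ℝ) < fiberCard y a := fun a => by exact_mod_cast fiberCard_pos y a
  have hzp : ∀ a, (0 : ℝ) < fiberCard z a := fun a => by exact_mod_cast fiberCard_pos z a
  have hwp : ∀ a, (0 : ℝ) < fiberCard (fun a => (x a, y a)) a := fun a => by
    exact_mod_cast fiberCard_pos (fun a => (x a, y a)) a
  have key : ∑ a, (Real.log (fiberCard x a) + Real.log (fiberCard y a)) ≤
      ∑ a, (Real.log (fiberCard (fun a => (x a, y a)) a) + Real.log (fiberCard z a)) := by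
    rw [← sub_nonpos, ← Finset.sum_sub_distrib]
    calc ∑ a, (Real.log (fiberCard x a) + Real.log (fiberCard y a) -
          (Real.log (fiberCard (fun a => (x a, y a)) a) + Real.log (fiberCard z a)))
        ≤ ∑ a, (((fiberCard x a : ℝ) * fiberCard y a) /
            (fiberCard (fun a => (x a, y a)) a * fiberCard z a) - 1) := by
          refine Finset.sum_le_sum fun a _ => ?_
          rw [← Real.log_mul (hxp a).ne' (hyp a).ne', ← Real.log_mul (hwp a).ne' (hzp a).ne',
            ← Real.log_div (mul_pos (hxp a) (hyp a)).ne' (mul_pos (hwp a) (hzp a)).ne']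
          -- The bound `log t ≤ t - 1` turns the logarithmic inequality into the counting bound on
          -- the sum of ratios.
          exact Real.log_le_sub_one_of_pos
            (div_pos (mul_pos (hxp a) (hyp a)) (mul_pos (hwp a) (hzp a)))
      _ ≤ 0 := by
          rw [Finset.sum_sub_distrib]
          simpa using sum_fiberCard_ratio_le hx hy
  rw [Finset.sum_add_distrib, Finset.sum_add_distrib] at key
  have := div_le_div_of_nonneg_right key (Nat.cast_nonneg (α := ℝ) (Fintype.card α))
  rw [add_div, add_div] at this
  unfold unifEntropy
  linarith

/-- Links fibre counting to the usual formula. The sum is over the image because the codomain, later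
an answer alphabet, may be infinite. -/
theorem unifEntropy_eq_sum_image [Nonempty α] [DecidableEq β] (f : α → β) :
    unifEntropy f = ∑ s ∈ Finset.univ.image f,
      Real.negMulLog ((Finset.univ.filter fun a => f a = s).card / Fintype.card α) := by
  have hc : (Fintype.card α : ℝ) ≠ 0 := by exact_mod_cast Fintype.card_ne_zero
  have h1 : ∑ a, (Real.log (fiberCard f a) - Real.log (Fintype.card α)) =
      ∑ s ∈ Finset.univ.image f, (Finset.univ.filter fun a => f a = s).card •
        (Real.log ((Finset.univ.filter fun a => f a = s).card) - Real.log (Fintype.card α)) := by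
    rw [← Finset.sum_comp (fun s => Real.log ((Finset.univ.filter fun a => f a = s).card : ℝ) -
      Real.log (Fintype.card α)) f]
    refine Finset.sum_congr rfl fun a _ => ?_
    unfold fiberCard
    congr!
  have h2 : unifEntropy f =
      -(∑ a, (Real.log (fiberCard f a) - Real.log (Fintype.card α))) / Fintype.card α := by
    unfold unifEntropy
    rw [Finset.sum_sub_distrib]
    simp
    field_simp
  rw [h2, h1, ← Finset.sum_neg_distrib, Finset.sum_div]
  refine Finset.sum_congr rfl fun s hs => ?_
  obtain ⟨a, -, rfl⟩ := Finset.mem_image.1 hs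
  have hp : ((Finset.univ.filter fun b => f b = f a).card : ℝ) ≠ 0 := by
    have : 0 < (Finset.univ.filter fun b => f b = f a).card := Finset.card_pos.2 ⟨a, by simp⟩
    positivity
  rw [Real.negMulLog, Real.log_div hp hc, nsmul_eq_mul]
  ring

end FiniteEntropy

/-! ### Submodular set functions and Han's inequality -/

section Shearer

variable {N : ℕ}

/-- A submodular set function dominates the sum of its increments along the chain of initial
segments. -/
theorem sum_increments_le_of_submodular (h : Finset (Fin N) → ℝ)
    (hsub : ∀ (n : Fin N) (s t : Finset (Fin N)), s ⊆ t →
      h (insert n t) + h s ≤ h (insert n s) + h t) (s : Finset (Fin N)) :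
    ∑ n ∈ s, (h (Finset.Iic n) - h (Finset.Iio n)) ≤ h s - h ∅ := by
  induction s using Finset.induction_on_max with
  | empty => simp
  | insert m s hm ih =>
    rw [Finset.sum_insert fun hmem => lt_irrefl _ (hm m hmem)]
    -- As `m` exceeds all of `s`, the initial segment below `m` contains `s`, so adding `m` to `s`
    -- gains at least as much as adding it to the segment.
    have h1 := hsub m s (Finset.Iio m) fun x hx => Finset.mem_Iio.2 (hm x hx)
    rw [Finset.Iio_insert] at h1
    linarith

theorem sum_increments_eq (h : Finset (Fin N) → ℝ) :
    ∑ n : Fin N, (h (Finset.Iic n) - h (Finset.Iio n)) = h Finset.univ - h ∅ := by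
  have key := Finset.sum_range_sub
    (fun j => h (Finset.univ.filter fun n : Fin N => n.val < j)) N
  rw [← Fin.sum_univ_eq_sum_range (fun j => h (Finset.univ.filter fun n : Fin N => n.val < j + 1) -
    h (Finset.univ.filter fun n : Fin N => n.val < j))] at key
  simp only [Fin.is_lt, Finset.filter_true, Nat.not_lt_zero, Finset.filter_false] at key
  rw [← key]
  refine Finset.sum_congr rfl fun n _ => ?_
  congr 2 <;> ext x
  · simp
  · simp

/-- The cyclic interval of length `T` that starts at `s`. -/
def cyclicInterval [NeZero N] (T : ℕ) (s : Fin N) : Finset (Fin N) :=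
  Finset.univ.filter fun n => (n - s).val < T

theorem card_filter_val_lt {T : ℕ} (hTN : T ≤ N) :
    (Finset.univ.filter fun n : Fin N => n.val < T).card = T := by
  rw [Fin.card_filter_val_lt]
  exact min_eq_right hTN

theorem card_cyclicInterval [NeZero N] {T : ℕ} (hTN : T ≤ N) (s : Fin N) :
    (cyclicInterval T s).card = T := by
  refine (Finset.card_equiv (Equiv.subRight s) fun n => ?_).trans (card_filter_val_lt hTN)
  simp [cyclicInterval]

theorem sum_cyclicInterval [NeZero N] {T : ℕ} (hTN : T ≤ N) (c : Fin N → ℝ) :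
    ∑ s, ∑ n ∈ cyclicInterval T s, c n = T * ∑ n, c n := by
  simp only [cyclicInterval, Finset.sum_filter]
  rw [Finset.sum_comm, Finset.mul_sum]
  refine Finset.sum_congr rfl fun n _ => ?_
  rw [← Finset.sum_filter, Finset.sum_const, nsmul_eq_mul]
  congr 2
  refine (Finset.card_equiv (Equiv.subLeft n) fun s => ?_).trans (card_filter_val_lt hTN)
  simp

/-- Han's inequality, averaged over cyclic intervals. -/
theorem mul_le_sum_cyclicInterval [NeZero N] {T : ℕ} (hTN : T ≤ N) (h : Finset (Fin N) → ℝ)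
    (hsub : ∀ (n : Fin N) (s t : Finset (Fin N)), s ⊆ t →
      h (insert n t) + h s ≤ h (insert n s) + h t) :
    T * (h Finset.univ - h ∅) ≤ ∑ s, (h (cyclicInterval T s) - h ∅) := by
  rw [← sum_increments_eq, ← sum_cyclicInterval hTN]
  exact Finset.sum_le_sum fun s _ => sum_increments_le_of_submodular h hsub _

theorem sub_le_sum_singleton (h : Finset (Fin N) → ℝ)
    (hsub : ∀ (n : Fin N) (s t : Finset (Fin N)), s ⊆ t →
      h (insert n t) + h s ≤ h (insert n s) + h t) :
    h Finset.univ - h ∅ ≤ ∑ n, (h {n} - h ∅) := by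
  rw [← sum_increments_eq]
  refine Finset.sum_le_sum fun n _ => ?_
  simpa using sum_increments_le_of_submodular h hsub {n}

end Shearer

/-! ### Uniform laws as the maximizers of entropy -/

theorem negMulLog_le_one_sub {t : ℝ} (ht : 0 ≤ t) : Real.negMulLog t ≤ 1 - t := by
  rcases ht.eq_or_lt with rfl | ht
  · simp
  have h := Real.one_sub_inv_le_log_of_pos ht
  have := mul_le_mul_of_nonneg_left h ht.le
  rw [mul_sub, mul_inv_cancel₀ ht.ne'] at this
  rw [Real.negMulLog]
  linarith

theorem eq_one_of_negMulLog_eq_one_sub {t : ℝ} (ht : 0 ≤ t) (h : Real.negMulLog t = 1 - t) :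
    t = 1 := by
  rcases ht.eq_or_lt with rfl | ht
  · simp at h
  by_contra hne
  have h1 := Real.log_lt_sub_one_of_pos (inv_pos.2 ht) (by simpa using hne)
  rw [Real.log_inv] at h1
  have := mul_lt_mul_of_pos_left h1 ht
  rw [mul_sub, mul_inv_cancel₀ ht.ne'] at this
  rw [Real.negMulLog] at h
  linarith

/-- The uniform law is the only one with maximal entropy on a finite type. -/
theorem eq_inv_card_of_sum_negMulLog {β : Type*} [Fintype β] (p : β → ℝ) (hp : ∀ s, 0 ≤ p s)
    (hsum : ∑ s, p s = 1) (h : ∑ s, Real.negMulLog (p s) = Real.log (Fintype.card β)) (s : β) :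
    p s = (Fintype.card β : ℝ)⁻¹ := by
  have hc : (0 : ℝ) < Fintype.card β := by
    have : Nonempty β := ⟨s⟩
    exact_mod_cast Fintype.card_pos
  set M : ℝ := ((Fintype.card β : ℕ) : ℝ) with hM
  have hterm : ∀ s, Real.negMulLog (p s * M) = M * Real.negMulLog (p s) - p s * M * Real.log M := by
    intro s
    rw [Real.negMulLog_mul]
    simp only [Real.negMulLog]
    ring
  -- Rescaled by `M`, maximal entropy says that nonnegative gaps sum to zero, so each gap vanishes
  -- and `p s * M = 1`.
  have hall : ∑ s, (1 - p s * M - Real.negMulLog (p s * M)) = 0 := by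
    simp only [hterm, Finset.sum_sub_distrib, ← Finset.mul_sum, ← Finset.sum_mul, hsum, h]
    simp [← hM]
  have := (Finset.sum_eq_zero_iff_of_nonneg fun s _ =>
    sub_nonneg.2 (negMulLog_le_one_sub (mul_nonneg (hp s) hc.le))).1 hall s (Finset.mem_univ _)
  have := eq_one_of_negMulLog_eq_one_sub (mul_nonneg (hp s) hc.le) (by linarith)
  exact eq_inv_of_mul_eq_one_left this

theorem negMulLog_real_preimage_nonneg {Ω S : Type} [MeasurableSpace Ω] (μ : Measure Ω)
    [IsProbabilityMeasure μ] (X : Ω → S) (s : S) : 0 ≤ Real.negMulLog (μ.real (X ⁻¹' {s})) :=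
  Real.negMulLog_nonneg measureReal_nonneg measureReal_le_one

theorem entropy_eq_ofReal_sum {Ω S : Type} [MeasurableSpace Ω] [Fintype S] (μ : Measure Ω)
    [IsProbabilityMeasure μ] (X : Ω → S) :
    entropy μ X = ENNReal.ofReal ((∑ s, Real.negMulLog (μ.real (X ⁻¹' {s}))) / Real.log 2) := by
  rw [entropy, tsum_fintype, Finset.sum_div, ENNReal.ofReal_sum_of_nonneg]
  exact fun s _ => div_nonneg (negMulLog_real_preimage_nonneg μ X s) (Real.log_nonneg (by norm_num))

theorem sum_real_preimage_singleton {Ω S : Type} [MeasurableSpace Ω] [Fintype S]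
    [MeasurableSpace S] [MeasurableSingletonClass S] (μ : Measure Ω)
    [IsProbabilityMeasure μ] {X : Ω → S} (hX : Measurable X) :
    ∑ s, μ.real (X ⁻¹' {s}) = 1 := by
  have := sum_measureReal_preimage_singleton (μ := μ) (f := X) Finset.univ
    (fun s _ => hX (measurableSet_singleton s))
  rw [this]
  simp

/-! ### The converse bound -/

namespace Scheme

variable {K N T : ℕ} (S : Scheme K N T)

/-- All the messages together. -/
def messages (ω : S.Ω) : Messages K S.L := fun i => S.W i ω

theorem measurable_messages : Measurable S.messages := measurable_pi_lambda _ S.measurable_W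

/-- A scheme prescribes only the entropy of a message; being the logarithm of the alphabet size, it
forces the uniform law. -/
theorem real_W_eq (i : Fin K) (s : Fin S.L → Bool) :
    S.μ.real (S.W i ⁻¹' {s}) = ((2 : ℝ) ^ S.L)⁻¹ := by
  have hlog : 0 < Real.log 2 := Real.log_pos (by norm_num)
  have h := S.entropy_W i
  rw [entropy_eq_ofReal_sum, ← ENNReal.ofReal_natCast,
    ENNReal.ofReal_eq_ofReal_iff (div_nonneg (Finset.sum_nonneg fun s _ =>
      negMulLog_real_preimage_nonneg _ _ s) hlog.le) (Nat.cast_nonneg _), div_eq_iff hlog.ne'] at h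
  have := eq_inv_card_of_sum_negMulLog (fun s => S.μ.real (S.W i ⁻¹' {s}))
    (fun _ => measureReal_nonneg) (sum_real_preimage_singleton S.μ (S.measurable_W i))
    (by rw [h]; simp) s
  simpa using this

theorem real_messages_eq (w : Messages K S.L) :
    S.μ.real (S.messages ⁻¹' {w}) = (Fintype.card (Messages K S.L) : ℝ)⁻¹ := by
  have h := S.indep_W.measure_inter_preimage_eq_mul Finset.univ (sets := fun i => {w i})
    (fun i _ => measurableSet_singleton _)
  have hset : S.messages ⁻¹' {w} = ⋂ i ∈ Finset.univ, S.W i ⁻¹' {w i} := by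
    ext ω
    simp [messages, funext_iff]
  rw [Measure.real, hset, h, ENNReal.toReal_prod]
  have : ∀ i, (S.μ (S.W i ⁻¹' {w i})).toReal = ((2 : ℝ) ^ S.L)⁻¹ := fun i => S.real_W_eq i (w i)
  simp [this]

theorem real_messages_inter (k : Fin K) (w : Messages K S.L) {E : Set (Fin N → S.Query)}
    (hE : MeasurableSet E) :
    S.μ.real (S.messages ⁻¹' {w} ∩ S.Q k ⁻¹' E) =
      (Fintype.card (Messages K S.L) : ℝ)⁻¹ * S.μ.real (S.Q k ⁻¹' E) := by
  rw [← S.real_messages_eq w, Measure.real, Measure.real, Measure.real, ← ENNReal.toReal_mul]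
  congr 1
  exact (S.indep_Q k).measure_inter_preimage_eq_mul _ _ (measurableSet_singleton w) hE

theorem measurable_answer_left (n : Fin N) (w : Messages K S.L) :
    Measurable fun x => S.answer n x w :=
  (S.measurable_answer n).comp (measurable_id.prodMk measurable_const)

/-- Almost all queries allow the desired message to be decoded, whatever the messages are. -/
theorem ae_forall_decode (k : Fin K) : ∀ᵐ ω ∂S.μ, ∀ w : Messages K S.L,
    S.decode k (fun n => S.answer n (S.Q k ω n) w) (S.Q k ω) = w k := by
  rw [ae_all_iff]
  intro w
  have hm : Measurable fun q : Fin N → S.Query => S.decode k (fun n => S.answer n (q n) w) q :=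
    (S.measurable_decode k).comp ((measurable_pi_lambda _ fun n =>
      (S.measurable_answer_left n w).comp (measurable_pi_apply n)).prodMk measurable_id)
  have hE : MeasurableSet {q | S.decode k (fun n => S.answer n (q n) w) q ≠ w k} :=
    (hm (measurableSet_singleton (w k))).compl
  have h := S.real_messages_inter k w hE
  have h0 : S.μ (S.messages ⁻¹' {w} ∩
      S.Q k ⁻¹' {q | S.decode k (fun n => S.answer n (q n) w) q ≠ w k}) = 0 := by
    refine measure_mono_null ?_ (ae_iff.1 (S.correct k))
    rintro ω ⟨h1, h2⟩
    have h1 : S.messages ω = w := h1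
    subst h1
    exact h2
  -- By independence, the null event "messages equal `w` and decoding fails" has probability a
  -- positive constant times that of bad queries for `w`.
  rw [Measure.real, h0, ENNReal.toReal_zero, eq_comm, mul_eq_zero] at h
  have h := h.resolve_left (by positivity)
  rw [measureReal_eq_zero_iff] at h
  exact h

/-- The entropy, in nats, of the first `j` messages together with the answers of the databases
in `s` to fixed queries, for uniformly distributed messages. -/
noncomputable def viewEntropy (j : ℕ) (s : Finset (Fin N)) (p : s → S.Query) : ℝ :=
  unifEntropy fun w : Messages K S.L =>
    ((fun i : {i : Fin K // i.val < j} => w i), fun n : s => S.answer n (p n) w)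

theorem measurable_viewEntropy (j : ℕ) (s : Finset (Fin N)) : Measurable (S.viewEntropy j s) := by
  classical
  unfold viewEntropy unifEntropy fiberCard
  refine measurable_const.sub (Measurable.div_const (Finset.measurable_sum _ fun a _ => ?_) _)
  refine Real.measurable_log.comp ?_
  simp only [Finset.card_filter, Nat.cast_sum]
  refine Finset.measurable_sum _ fun b _ => ?_
  have : MeasurableSet {p : s → S.Query |
      ((fun i : {i : Fin K // i.val < j} => b i), fun n : s => S.answer n (p n) b) =
      ((fun i : {i : Fin K // i.val < j} => a i), fun n : s => S.answer n (p n) a)} := by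
    have hf : ∀ w, Measurable fun p : s → S.Query =>
        ((fun i : {i : Fin K // i.val < j} => w i), fun n : s => S.answer n (p n) w) := fun w =>
      measurable_const.prodMk (measurable_pi_lambda _ fun n =>
        (S.measurable_answer_left n w).comp (measurable_pi_apply n))
    exact measurableSet_eq_fun (hf b) (hf a)
  simp only [Nat.cast_ite, Nat.cast_one, Nat.cast_zero]
  exact Measurable.ite this measurable_const measurable_const

/-- The expected value of `viewEntropy` when message `k` is desired. -/
noncomputable def meanViewEntropy (k : Fin K) (j : ℕ) (s : Finset (Fin N)) : ℝ :=
  ∫ ω, S.viewEntropy j s (fun n => S.Q k ω n) ∂S.μ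

theorem measurable_queries (k : Fin K) (s : Finset (Fin N)) :
    Measurable fun ω (n : s) => S.Q k ω n :=
  measurable_pi_lambda _ fun n => (measurable_pi_apply n.1).comp (S.measurable_Q k)

theorem integrable_viewEntropy (k : Fin K) (j : ℕ) (s : Finset (Fin N)) :
    Integrable (fun ω => S.viewEntropy j s (fun n => S.Q k ω n)) S.μ := by
  refine Integrable.of_bound
    ((S.measurable_viewEntropy j s).comp (S.measurable_queries k s)).aestronglyMeasurable
    (Real.log (Fintype.card (Messages K S.L))) (Filter.Eventually.of_forall fun ω => ?_)
  refine (Real.norm_of_nonneg (unifEntropy_nonneg _)).trans_le ?_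
  exact unifEntropy_le_log_card _

theorem meanViewEntropy_eq_of_card_eq (k k' : Fin K) (j : ℕ) {s : Finset (Fin N)}
    (hs : s.card = T) : S.meanViewEntropy k j s = S.meanViewEntropy k' j s :=
  ((S.privacy s hs k k').comp (S.measurable_viewEntropy j s)).integral_eq

theorem meanViewEntropy_le_univ (k : Fin K) (j : ℕ) (s : Finset (Fin N)) :
    S.meanViewEntropy k j s ≤ S.meanViewEntropy k j Finset.univ := by
  refine integral_mono (S.integrable_viewEntropy k j s) (S.integrable_viewEntropy k j _) fun ω => ?_
  refine unifEntropy_le_of_ker_le fun a b h => ?_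
  simp only [Prod.mk.injEq, funext_iff] at h ⊢
  exact ⟨h.1, fun n => h.2 ⟨n, Finset.mem_univ _⟩⟩

/-- The entropy, in nats, of the first `j` messages. -/
noncomputable def prefixEntropy (j : ℕ) : ℝ :=
  unifEntropy fun (w : Messages K S.L) (i : {i : Fin K // i.val < j}) => w i

theorem viewEntropy_empty (j : ℕ) (p : (∅ : Finset (Fin N)) → S.Query) :
    S.viewEntropy j ∅ p = S.prefixEntropy j :=
  unifEntropy_congr fun a b => by
    simp only [Prod.mk.injEq, and_iff_left_iff_imp]
    exact fun _ => funext fun n => absurd n.2 (Finset.notMem_empty _)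

theorem prefixEntropy_le_meanViewEntropy (k : Fin K) (j : ℕ) (s : Finset (Fin N)) :
    S.prefixEntropy j ≤ S.meanViewEntropy k j s := by
  have := integral_mono (integrable_const (S.prefixEntropy j)) (S.integrable_viewEntropy k j s)
    fun ω => unifEntropy_le_of_ker_le fun a b h => by
      simp only [Prod.mk.injEq] at h
      exact h.1
  simpa [meanViewEntropy] using this

theorem viewEntropy_submodular (j : ℕ) (q : Fin N → S.Query) (n : Fin N) (s t : Finset (Fin N))
    (hst : s ⊆ t) :
    S.viewEntropy j (insert n t) (fun m => q m) + S.viewEntropy j s (fun m => q m) ≤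
      S.viewEntropy j (insert n s) (fun m => q m) + S.viewEntropy j t (fun m => q m) := by
  unfold viewEntropy
  refine le_trans (le_of_eq ?_) (unifEntropy_prod_add_le (z := fun w : Messages K S.L =>
    ((fun i : {i : Fin K // i.val < j} => w i), fun m : s => S.answer m (q m) w)) ?_ ?_)
  · congr 1
    refine unifEntropy_congr fun a b => ?_
    simp only [Prod.mk.injEq, funext_iff, Subtype.forall, Finset.mem_insert, forall_eq_or_imp]
    exact ⟨fun h => ⟨⟨h.1, h.2.1, fun m hm => h.2.2 m (hst hm)⟩, h.1, h.2.2⟩,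
      fun h => ⟨h.1.1, h.1.2.1, h.2.2⟩⟩
  · intro a b h
    simp only [Prod.mk.injEq, funext_iff, Subtype.forall, Finset.mem_insert,
      forall_eq_or_imp] at h ⊢
    exact ⟨h.1, h.2.2⟩
  · intro a b h
    simp only [Prod.mk.injEq, funext_iff, Subtype.forall] at h ⊢
    exact ⟨h.1, fun m hm => h.2 m (hst hm)⟩

/-- The only use of privacy in the converse: Han's inequality for index `k'` reduces to sets of
exactly `T` databases, where the desired index can be exchanged for `k`. -/
theorem mul_meanViewEntropy_le (hN : 0 < N) (hTN : T ≤ N) (k k' : Fin K) (j : ℕ) :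
    T * (S.meanViewEntropy k' j Finset.univ - S.prefixEntropy j) ≤
      N * (S.meanViewEntropy k j Finset.univ - S.prefixEntropy j) := by
  have : NeZero N := ⟨hN.ne'⟩
  have hpt : ∀ ω, T * (S.viewEntropy j Finset.univ (fun n => S.Q k' ω n) - S.prefixEntropy j) ≤
      ∑ s, (S.viewEntropy j (cyclicInterval T s) (fun n => S.Q k' ω n) - S.prefixEntropy j) := by
    intro ω
    have := mul_le_sum_cyclicInterval hTN (fun s => S.viewEntropy j s fun n => S.Q k' ω n)
      (S.viewEntropy_submodular j (S.Q k' ω))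
    simpa only [viewEntropy_empty] using this
  have hint : ∀ s, Integrable
      (fun ω => S.viewEntropy j s (fun n => S.Q k' ω n) - S.prefixEntropy j) S.μ :=
    fun s => (S.integrable_viewEntropy k' j s).sub (integrable_const _)
  have hval : ∀ s, ∫ ω, (S.viewEntropy j s (fun n => S.Q k' ω n) - S.prefixEntropy j) ∂S.μ =
      S.meanViewEntropy k' j s - S.prefixEntropy j := fun s => by
    rw [integral_sub (S.integrable_viewEntropy k' j s) (integrable_const _)]
    simp [meanViewEntropy]
  have h := integral_mono ((hint _).const_mul _) (integrable_finsetSum _ fun s _ => hint _) hpt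
  rw [integral_const_mul, hval, integral_finsetSum _ fun s _ => hint _] at h
  refine h.trans ?_
  calc ∑ s, ∫ ω, (S.viewEntropy j (cyclicInterval T s) (fun n => S.Q k' ω n) -
        S.prefixEntropy j) ∂S.μ
      ≤ ∑ s : Fin N, (S.meanViewEntropy k j Finset.univ - S.prefixEntropy j) := by
        refine Finset.sum_le_sum fun s _ => ?_
        rw [hval, S.meanViewEntropy_eq_of_card_eq k' k j (card_cyclicInterval hTN s)]
        exact sub_le_sub_right (S.meanViewEntropy_le_univ k j _) _
    _ = _ := by simp [mul_sub]

/-- For almost all queries the answers determine message `k`, so adjoining it to the view leaves the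
kernel unchanged. With indices from zero, the first `k.val` messages are those strictly before `k`.
-/
theorem meanViewEntropy_succ (k : Fin K) :
    S.meanViewEntropy k k.val Finset.univ = S.meanViewEntropy k (k.val + 1) Finset.univ := by
  refine integral_congr_ae ?_
  filter_upwards [S.ae_forall_decode k] with ω hω
  refine unifEntropy_congr fun a b => ?_
  simp only [Prod.mk.injEq, funext_iff, Subtype.forall, Finset.mem_univ, forall_const]
  refine ⟨fun h => ⟨fun i hi => ?_, h.2⟩, fun h => ⟨fun i hi => h.1 i (by omega), h.2⟩⟩
  rcases Nat.lt_succ_iff_lt_or_eq.1 hi with hi | hi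
  · exact h.1 i hi
  · obtain rfl : i = k := Fin.ext hi
    rw [← hω a, ← hω b, show (fun n => S.answer n (S.Q i ω n) a) =
      fun n => S.answer n (S.Q i ω n) b from funext h.2]
    simp

theorem fiberCard_prefix (j : ℕ) (w : Messages K S.L) :
    fiberCard (fun (w : Messages K S.L) (i : {i : Fin K // i.val < j}) => w i) w =
      ∏ i : Fin K, if i.val < j then 1 else 2 ^ S.L := by
  classical
  have : (Finset.univ.filter fun w' : Messages K S.L =>
      ∀ i : Fin K, i.val < j → w' i = w i) =
      Fintype.piFinset fun i : Fin K => if i.val < j then {w i} else Finset.univ := by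
    ext w'
    simp only [Finset.mem_filter, Finset.mem_univ, true_and,
      Fintype.mem_piFinset]
    refine forall_congr' fun i => ?_
    split_ifs with h <;> simp [h]
  have h2 : fiberCard (fun (w : Messages K S.L) (i : {i : Fin K // i.val < j}) => w i) w =
      (Finset.univ.filter fun w' : Messages K S.L =>
      ∀ i : Fin K, i.val < j → w' i = w i).card := by
    unfold fiberCard
    congr 1
    ext w'
    simp [funext_iff]
  rw [h2, this, Fintype.card_piFinset]
  refine Finset.prod_congr rfl fun i _ => ?_
  split_ifs <;> simp

theorem prefixEntropy_succ (k : Fin K) :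
    S.prefixEntropy (k.val + 1) = S.prefixEntropy k.val + S.L * Real.log 2 := by
  have hlog : ∀ j, Real.log ((∏ i : Fin K, if i.val < j then 1 else 2 ^ S.L : ℕ) : ℝ) =
      ∑ i : Fin K, if i.val < j then 0 else S.L * Real.log 2 := by
    intro j
    push_cast
    rw [Real.log_prod]
    · refine Finset.sum_congr rfl fun i _ => ?_
      split_ifs <;> simp
    · intro i _
      split_ifs <;> positivity
  have hval : ∀ j, S.prefixEntropy j = Real.log (Fintype.card (Messages K S.L)) -
      ∑ i : Fin K, if i.val < j then 0 else S.L * Real.log 2 := by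
    intro j
    unfold prefixEntropy unifEntropy
    simp only [fiberCard_prefix, hlog]
    rw [Finset.sum_const, nsmul_eq_mul, Finset.card_univ, mul_div_cancel_left₀]
    exact_mod_cast Fintype.card_ne_zero
  have hdiff : (∑ i : Fin K, if i.val < k.val then 0 else S.L * Real.log 2) -
      (∑ i : Fin K, if i.val < k.val + 1 then 0 else S.L * Real.log 2) = S.L * Real.log 2 := by
    rw [← Finset.sum_sub_distrib, Finset.sum_eq_single k]
    · simp
    · intro i _ hi
      have : i.val ≠ k.val := fun h => hi (Fin.ext h)
      by_cases h : i.val < k.val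
      · simp [h, h.le]
      · simp [h, show ¬ i.val ≤ k.val by omega]
    · simp
  rw [hval, hval]
  linarith

/-- Downward induction from the last message, with `d` the number of messages after `k`; each step
multiplies the previous bound by `T / N` and adds one message's worth of entropy. -/
theorem geom_sum_le_meanViewEntropy (hT : 1 ≤ T) (hTN : T ≤ N) (d : ℕ) :
    ∀ k : Fin K, k.val + d + 1 = K →
      S.L * Real.log 2 * ∑ i ∈ Finset.range (d + 1), ((T : ℝ) / N) ^ i ≤
        S.meanViewEntropy k k.val Finset.univ - S.prefixEntropy k.val := by
  have hN : (0 : ℝ) < N := by exact_mod_cast (by omega : 0 < N)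
  induction d with
  | zero =>
    intro k _
    have h1 := S.prefixEntropy_le_meanViewEntropy k (k.val + 1) Finset.univ
    rw [S.prefixEntropy_succ] at h1
    rw [S.meanViewEntropy_succ]
    simp
    linarith
  | succ d ih =>
    intro k hk
    have h1 := ih ⟨k.val + 1, by omega⟩ (by simp; omega)
    have h2 := S.mul_meanViewEntropy_le (by omega) hTN k ⟨k.val + 1, by omega⟩ (k.val + 1)
    rw [← S.meanViewEntropy_succ] at h2
    simp only at h1
    have h3 := mul_le_mul_of_nonneg_left h1 (Nat.cast_nonneg (α := ℝ) T)
    have h4 := h3.trans h2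
    rw [mul_comm (N : ℝ), ← div_le_iff₀ hN] at h4
    rw [Finset.sum_range_succ']
    simp only [pow_succ, ← Finset.sum_mul]
    rw [S.prefixEntropy_succ] at h4
    calc _ = T * (S.L * Real.log 2 * ∑ i ∈ Finset.range (d + 1), ((T : ℝ) / N) ^ i) / N +
          S.L * Real.log 2 := by
          simp
          field_simp
      _ ≤ _ := by linarith

-- Disintegration over the queries: the messages stay uniform given the queries, so the law of an
-- answer is the mean of its conditional laws. Jensen's inequality can then be applied to it.
open Classical in
theorem real_A_eq_integral (k : Fin K) (n : Fin N) (s : S.Answer) :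
    S.μ.real (S.A k n ⁻¹' {s}) = ∫ ω, ((Finset.univ.filter fun w : Messages K S.L =>
      S.answer n (S.Q k ω n) w = s).card : ℝ) / Fintype.card (Messages K S.L) ∂S.μ := by
  have hE : ∀ w, MeasurableSet {q : Fin N → S.Query | S.answer n (q n) w = s} := fun w =>
    ((S.measurable_answer_left n w).comp (measurable_pi_apply n)) (measurableSet_singleton s)
  have h1 : S.A k n ⁻¹' {s} = ⋃ w ∈ (Finset.univ : Finset (Messages K S.L)),
      (S.messages ⁻¹' {w} ∩ S.Q k ⁻¹' {q | S.answer n (q n) w = s}) := by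
    ext ω
    simp only [Set.mem_preimage, Set.mem_singleton_iff, Finset.mem_univ, Set.iUnion_true,
      Set.mem_iUnion, Set.mem_inter_iff, exists_eq_left', Set.mem_ofPred_eq]
    rfl
  have h2 : ∀ ω, ((Finset.univ.filter fun w : Messages K S.L =>
      S.answer n (S.Q k ω n) w = s).card : ℝ) / Fintype.card (Messages K S.L) =
      ∑ w : Messages K S.L, (Fintype.card (Messages K S.L) : ℝ)⁻¹ *
        (S.Q k ⁻¹' {q | S.answer n (q n) w = s}).indicator (fun _ => (1 : ℝ)) ω := by
    intro ω
    rw [← Finset.mul_sum, div_eq_inv_mul]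
    simp [Set.indicator_apply]
  have hm : ∀ w, MeasurableSet (S.Q k ⁻¹' {q | S.answer n (q n) w = s}) := fun w =>
    S.measurable_Q k (hE w)
  simp only [h2]
  rw [h1, measureReal_biUnion_finset, integral_finsetSum]
  · refine Finset.sum_congr rfl fun w _ => ?_
    rw [S.real_messages_inter k w (hE w), integral_const_mul, integral_indicator_const _ (hm w)]
    simp
  · exact fun w _ => ((integrable_const _).indicator (hm w)).const_mul _
  · intro w _ w' _ hne
    refine Set.disjoint_left.2 fun ω h h' => hne ?_
    exact h.1.symm.trans h'.1
  · exact fun w _ => (S.measurable_messages (measurableSet_singleton w)).inter (hm w)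

/-- Conditioning on the queries does not increase the entropy of an answer. -/
theorem meanViewEntropy_singleton_le_entropy (k : Fin K) (n : Fin N) :
    ENNReal.ofReal (S.meanViewEntropy k 0 {n} / Real.log 2) ≤ entropy S.μ (S.A k n) := by
  classical
  set p : S.Answer → S.Ω → ℝ := fun s ω => ((Finset.univ.filter fun w : Messages K S.L =>
      S.answer n (S.Q k ω n) w = s).card : ℝ) / Fintype.card (Messages K S.L) with hp
  have hlog : 0 < Real.log 2 := Real.log_pos (by norm_num)
  have hc : (0 : ℝ) < Fintype.card (Messages K S.L) := by exact_mod_cast Fintype.card_pos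
  have hp0 : ∀ s ω, 0 ≤ p s ω := fun s ω => by positivity
  have hp1 : ∀ s ω, p s ω ≤ 1 := fun s ω => by
    rw [hp, div_le_one hc]
    exact_mod_cast Finset.card_le_univ _
  have hpm : ∀ s, Measurable (p s) := by
    intro s
    simp only [hp, Finset.card_filter, Nat.cast_sum, Nat.cast_ite, Nat.cast_one, Nat.cast_zero]
    refine Measurable.div_const (Finset.measurable_sum _ fun w _ => ?_) _
    exact Measurable.ite (((S.measurable_answer_left n w).comp ((measurable_pi_apply n).comp
      (S.measurable_Q k))) (measurableSet_singleton s)) measurable_const measurable_const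
  have hpint : ∀ s, Integrable (p s) S.μ := fun s =>
    Integrable.of_bound (hpm s).aestronglyMeasurable 1 (Filter.Eventually.of_forall fun ω => by
      rw [Real.norm_of_nonneg (hp0 s ω)]; exact hp1 s ω)
  have hnint : ∀ s, Integrable (fun ω => Real.negMulLog (p s ω)) S.μ := fun s =>
    Integrable.of_bound (Real.continuous_negMulLog.measurable.comp (hpm s)).aestronglyMeasurable 1
      (Filter.Eventually.of_forall fun ω => by
        rw [Real.norm_of_nonneg (Real.negMulLog_nonneg (hp0 s ω) (hp1 s ω))]
        linarith [negMulLog_le_one_sub (hp0 s ω), hp0 s ω])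
  have hjensen : ∀ s, ∫ ω, Real.negMulLog (p s ω) ∂S.μ ≤
      Real.negMulLog (S.μ.real (S.A k n ⁻¹' {s})) := by
    intro s
    rw [S.real_A_eq_integral]
    exact Real.concaveOn_negMulLog.le_map_integral Real.continuous_negMulLog.continuousOn
      isClosed_Ici (Filter.Eventually.of_forall fun ω => hp0 s ω) (hpint s) (hnint s)
  calc ENNReal.ofReal (S.meanViewEntropy k 0 {n} / Real.log 2)
      = ∫⁻ ω, ENNReal.ofReal (S.viewEntropy 0 {n} (fun m => S.Q k ω m) / Real.log 2) ∂S.μ := by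
        rw [meanViewEntropy, ← integral_div, ofReal_integral_eq_lintegral_ofReal
          ((S.integrable_viewEntropy k 0 {n}).div_const _)
          (Filter.Eventually.of_forall fun ω => div_nonneg (unifEntropy_nonneg _) hlog.le)]
    _ ≤ ∫⁻ ω, ∑' s, ENNReal.ofReal (Real.negMulLog (p s ω) / Real.log 2) ∂S.μ := by
        refine lintegral_mono fun ω => ?_
        have h1 : S.viewEntropy 0 {n} (fun m => S.Q k ω m) =
            unifEntropy fun w : Messages K S.L => S.answer n (S.Q k ω n) w :=
          unifEntropy_congr fun a b => by
            simp [funext_iff]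
        simp only
        rw [h1, unifEntropy_eq_sum_image, Finset.sum_div, ENNReal.ofReal_sum_of_nonneg
          fun s _ => div_nonneg (Real.negMulLog_nonneg (hp0 s ω) (hp1 s ω)) hlog.le]
        exact ENNReal.sum_le_tsum _
    _ = ∑' s, ∫⁻ ω, ENNReal.ofReal (Real.negMulLog (p s ω) / Real.log 2) ∂S.μ :=
        lintegral_tsum fun s => ((Real.continuous_negMulLog.measurable.comp
          (hpm s)).div_const _).ennreal_ofReal.aemeasurable
    _ ≤ entropy S.μ (S.A k n) := by
        refine ENNReal.tsum_le_tsum fun s => ?_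
        rw [← ofReal_integral_eq_lintegral_ofReal ((hnint s).div_const _)
          (Filter.Eventually.of_forall fun ω =>
            div_nonneg (Real.negMulLog_nonneg (hp0 s ω) (hp1 s ω)) hlog.le), integral_div]
        exact ENNReal.ofReal_le_ofReal (div_le_div_of_nonneg_right (hjensen s) hlog.le)

theorem meanViewEntropy_univ_le_download (k : Fin K) :
    ENNReal.ofReal ((S.meanViewEntropy k 0 Finset.univ - S.prefixEntropy 0) / Real.log 2) ≤
      S.download k := by
  have hlog : 0 < Real.log 2 := Real.log_pos (by norm_num)
  have h0 : S.prefixEntropy 0 = 0 := by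
    have := unifEntropy_congr (f := fun (w : Messages K S.L) (i : {i : Fin K // i.val < 0}) => w i)
      (g := fun _ => ()) (by simp [funext_iff])
    rw [prefixEntropy, this]
    simp [unifEntropy, fiberCard]
  have hpt : ∀ ω, S.viewEntropy 0 Finset.univ (fun n => S.Q k ω n) ≤
      ∑ n, S.viewEntropy 0 {n} (fun m => S.Q k ω m) := by
    intro ω
    have := sub_le_sum_singleton (fun s => S.viewEntropy 0 s fun n => S.Q k ω n)
      (S.viewEntropy_submodular 0 (S.Q k ω))
    simpa only [viewEntropy_empty, h0, sub_zero] using this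
  have hint := integral_mono (S.integrable_viewEntropy k 0 _)
    (integrable_finsetSum _ fun n _ => S.integrable_viewEntropy k 0 {n}) hpt
  rw [integral_finsetSum _ fun n _ => S.integrable_viewEntropy k 0 {n}] at hint
  calc ENNReal.ofReal ((S.meanViewEntropy k 0 Finset.univ - S.prefixEntropy 0) / Real.log 2)
      ≤ ENNReal.ofReal (∑ n, S.meanViewEntropy k 0 {n} / Real.log 2) := by
        rw [h0, sub_zero, ← Finset.sum_div]
        exact ENNReal.ofReal_le_ofReal (div_le_div_of_nonneg_right hint hlog.le)
    _ = ∑ n, ENNReal.ofReal (S.meanViewEntropy k 0 {n} / Real.log 2) :=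
        ENNReal.ofReal_sum_of_nonneg fun n _ =>
          div_nonneg (integral_nonneg fun ω => unifEntropy_nonneg _) hlog.le
    _ ≤ S.download k := Finset.sum_le_sum fun n _ => S.meanViewEntropy_singleton_le_entropy k n

/-- The converse: no scheme beats the capacity. -/
theorem rate_le (hK : 1 ≤ K) (hT : 1 ≤ T) (hTN : T ≤ N) :
    S.rate ≤ ENNReal.ofReal ((∑ i ∈ Finset.range K, (T : ℝ) ^ i / (N : ℝ) ^ i)⁻¹) := by
  have hlog : 0 < Real.log 2 := Real.log_pos (by norm_num)
  have h := S.geom_sum_le_meanViewEntropy hT hTN (K - 1) ⟨0, hK⟩ (by simp; omega)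
  rw [Nat.sub_add_cancel hK] at h
  simp only [div_pow] at h
  set G : ℝ := ∑ i ∈ Finset.range K, (T : ℝ) ^ i / (N : ℝ) ^ i with hG
  have hGpos : 0 < G := by
    refine Finset.sum_pos (fun i _ => ?_) ⟨0, Finset.mem_range.2 hK⟩
    have : 0 < T := hT
    have : 0 < N := by omega
    positivity
  -- A bound for one desired index suffices, as the rate divides by the supremum.
  have h1 : ENNReal.ofReal (S.L * G) ≤ ⨆ k, S.download k := by
    refine le_trans ?_ ((S.meanViewEntropy_univ_le_download ⟨0, hK⟩).trans
      (le_iSup S.download ⟨0, hK⟩))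
    refine ENNReal.ofReal_le_ofReal ((le_div_iff₀ hlog).2 ?_)
    calc S.L * G * Real.log 2 = S.L * Real.log 2 * G := by ring
      _ ≤ _ := h
  unfold rate
  refine ENNReal.div_le_of_le_mul ?_
  calc (S.L : ℝ≥0∞) = ENNReal.ofReal G⁻¹ * ENNReal.ofReal (S.L * G) := by
        rw [← ENNReal.ofReal_mul (by positivity), ← ENNReal.ofReal_natCast]
        congr 1
        field_simp
    _ ≤ _ := by gcongr

end Scheme

/-! ### The Reed–Solomon code and interference alignment -/

/-- Two surjective homomorphisms between the same finite groups differ by a permutation. -/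
theorem exists_perm_comp_eq_of_surjective {G H : Type*} [AddGroup G] [AddGroup H] [Finite G]
    (f g : G →+ H) (hf : Function.Surjective f) (hg : Function.Surjective g) :
    ∃ P : Equiv.Perm G, ∀ x, g (P x) = f x := by
  classical
  have := Fintype.ofFinite G
  have := Finite.of_surjective f hf
  have := Fintype.ofFinite H
  -- All fibres have size `|G| / |H|`, whichever homomorphism is taken, so fibres over equal points
  -- can be matched and the matchings glued.
  have hfib : ∀ φ : G →+ H, Function.Surjective φ → ∀ y,
      Fintype.card G = Fintype.card H * Fintype.card {x // φ x = y} := by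
    intro φ hφ y
    rw [← Fintype.card_congr (Equiv.sigmaFiberEquiv φ), Fintype.card_sigma,
      ← Finset.card_univ, ← smul_eq_mul, ← Finset.sum_const]
    refine Finset.sum_congr rfl fun z _ => ?_
    rw [Fintype.card_subtype, Fintype.card_subtype]
    exact AddMonoidHom.card_fiber_eq_of_mem_range φ (hφ z) (hφ y)
  have hcard : ∀ y, Fintype.card {x // f x = y} = Fintype.card {x // g x = y} := fun y =>
    Nat.eq_of_mul_eq_mul_left (Fintype.card_pos_iff.2 ⟨y⟩) ((hfib f hf y).symm.trans (hfib g hg y))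
  refine ⟨(Equiv.sigmaFiberEquiv f).symm.trans ((Equiv.sigmaCongrRight fun y =>
    Fintype.equivOfCardEq (hcard y)).trans (Equiv.sigmaFiberEquiv g)), fun x => ?_⟩
  exact ((Fintype.equivOfCardEq (hcard (f x))) ⟨x, rfl⟩).2

section Code

variable {F : Type*} [Field F] {K N : ℕ}

/-- The positions of the systematic symbols of the code. -/
def systematicPositions (N T : ℕ) : Finset (Fin N × Fin N) :=
  Finset.univ ×ˢ Finset.univ.filter fun a => a.val < T

/-- The coefficients of a systematic Reed–Solomon code of length `N ^ 2` and dimension `N * T`. -/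
noncomputable def codeCoeff (T : ℕ) (pt : Fin N × Fin N → F) (p p' : Fin N × Fin N) : F :=
  (Lagrange.basis (systematicPositions N T) pt p').eval (pt p)

theorem card_systematicPositions {T : ℕ} (hTN : T ≤ N) :
    (systematicPositions N T).card = N * T := by
  rw [systematicPositions, Finset.card_product, card_filter_val_lt hTN, Finset.card_univ,
    Fintype.card_fin]

theorem sum_codeCoeff_of_mem {T : ℕ} {pt : Fin N × Fin N → F} (hpt : Function.Injective pt)
    {p : Fin N × Fin N} (hp : p ∈ systematicPositions N T) (x : Fin N × Fin N → F) :
    ∑ p' ∈ systematicPositions N T, codeCoeff T pt p p' * x p' = x p := by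
  rw [Finset.sum_eq_single p]
  · rw [codeCoeff, Lagrange.eval_basis_self hpt.injOn hp, one_mul]
  · intro p' _ hne
    rw [codeCoeff, Lagrange.eval_basis_of_ne hne hp, zero_mul]
  · exact fun h => absurd hp h

/-- The symbols of any `T` databases form an information set of the code. -/
theorem exists_codeword {T : ℕ} (hTN : T ≤ N) {pt : Fin N × Fin N → F}
    (hpt : Function.Injective pt) {s : Finset (Fin N)} (hs : s.card = T)
    (y : Fin N × Fin N → F) :
    ∃ x : Fin N × Fin N → F, ∀ p : Fin N × Fin N, p.1 ∈ s →
      ∑ p' ∈ systematicPositions N T, codeCoeff T pt p p' * x p' = y p := by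
  set I : Finset (Fin N × Fin N) := s ×ˢ Finset.univ with hI
  have hcard : I.card = (systematicPositions N T).card := by
    rw [card_systematicPositions hTN, hI, Finset.card_product, hs, Finset.card_univ,
      Fintype.card_fin, mul_comm]
  have hdeg := Lagrange.degree_interpolate_lt y (hpt.injOn (s := I))
  rw [hcard] at hdeg
  -- The polynomial interpolating `y` on the `N * T` positions held by `s` has degree below `N * T`,
  -- so its values at the equally many systematic positions determine it.
  have heq := Lagrange.eq_interpolate hpt.injOn hdeg
  refine ⟨fun p' => (Lagrange.interpolate I pt y).eval (pt p'), fun p hp => ?_⟩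
  rw [← Lagrange.eval_interpolate_at_node y (hpt.injOn (s := I)) (i := p) (by simp [hI, hp])]
  conv_rhs => rw [heq, Lagrange.interpolate_apply, Polynomial.eval_finsetSum]
  refine Finset.sum_congr rfl fun p' _ => ?_
  rw [Polynomial.eval_mul, Polynomial.eval_C, mul_comm]
  rfl

/-- The symbols of message `i`: one for each database and each slot `σ` with `T ≤ σ i`. -/
abbrev SymbolIndex (K N T : ℕ) (i : Fin K) : Type :=
  {c : Fin N × (Fin K → Fin N) // T ≤ (c.2 i).val}

open Classical in
/-- The symbols of a message, extended by zero to all slots. -/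
noncomputable def extendSymbols {T : ℕ} {i : Fin K} (x : SymbolIndex K N T i → F)
    (c : Fin N × (Fin K → Fin N)) : F :=
  if h : T ≤ (c.2 i).val then x ⟨c, h⟩ else 0

/-- The contribution of message `i` to slot `σ` of database `n` when message `k` is desired. The
symbols of the desired message are used uncoded, all others are encoded along direction `k`. -/
noncomputable def encode (T : ℕ) (pt : Fin N × Fin N → F) (k i : Fin K)
    (x : SymbolIndex K N T i → F) (n : Fin N) (σ : Fin K → Fin N) : F :=
  if k = i then extendSymbols x (n, σ) else
    ∑ p ∈ systematicPositions N T,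
      codeCoeff T pt (n, σ k) p * extendSymbols x (p.1, Function.update σ k p.2)

theorem encode_eq_zero {T : ℕ} (pt : Fin N × Fin N → F) (k i : Fin K)
    (x : SymbolIndex K N T i → F) (n : Fin N) {σ : Fin K → Fin N} (h : (σ i).val < T) :
    encode T pt k i x n σ = 0 := by
  unfold encode
  split_ifs with hki
  · simp [extendSymbols, h]
  · refine Finset.sum_eq_zero fun p _ => ?_
    rw [extendSymbols, dif_neg, mul_zero]
    simpa [Function.update_of_ne (Ne.symm hki)] using h

theorem encode_add {T : ℕ} (pt : Fin N × Fin N → F) (k i : Fin K)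
    (x y : SymbolIndex K N T i → F) (n : Fin N) (σ : Fin K → Fin N) :
    encode T pt k i (x + y) n σ = encode T pt k i x n σ + encode T pt k i y n σ := by
  have hadd : ∀ c, extendSymbols (x + y) c = extendSymbols x c + extendSymbols y c := by
    intro c
    unfold extendSymbols
    split_ifs <;> simp
  unfold encode
  split_ifs with hki
  · exact hadd _
  · simp [hadd, mul_add, Finset.sum_add_distrib]

/-- The contributions of message `i` to the databases in `s`. -/
noncomputable def encodeHom {T : ℕ} (pt : Fin N × Fin N → F) (k i : Fin K) (s : Finset (Fin N)) :
    (SymbolIndex K N T i → F) →+ ({c : SymbolIndex K N T i // c.1.1 ∈ s} → F) :=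
  AddMonoidHom.mk' (fun x c => encode T pt k i x c.1.1.1 c.1.1.2) fun x y =>
    funext fun _ => encode_add pt k i x y _ _

/-- The uncoded case is a coordinate projection. In the coded case each line in direction `k`
carries its own codeword, and the databases in `s` hold an information set of it. -/
theorem encodeHom_surjective {T : ℕ} (hTN : T ≤ N) {pt : Fin N × Fin N → F}
    (hpt : Function.Injective pt) (k i : Fin K) {s : Finset (Fin N)} (hs : s.card = T) :
    Function.Surjective (encodeHom (T := T) pt k i s) := by
  classical
  intro y
  set y' : Fin N × (Fin K → Fin N) → F := fun c =>
    if h : T ≤ (c.2 i).val ∧ c.1 ∈ s then y ⟨⟨c, h.1⟩, h.2⟩ else 0 with hy'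
  have hval : ∀ c : {c : SymbolIndex K N T i // c.1.1 ∈ s}, y' c.1.1 = y c := fun c =>
    dif_pos ⟨c.1.2, c.2⟩
  by_cases hki : k = i
  · refine ⟨fun c => y' c.1, funext fun c => ?_⟩
    rw [← hval c]
    change encode T pt k i _ _ _ = _
    rw [encode, if_pos hki, extendSymbols, dif_pos c.1.2]
  · choose sol hsol using exists_codeword hTN hpt hs
    -- The prescribed values are restricted to the line through `c` in direction `k`; this depends
    -- only on the line, so the solutions fit together.
    refine ⟨fun c => sol (fun p => y' (p.1, Function.update c.1.2 k p.2)) (c.1.1, c.1.2 k),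
      funext fun c => ?_⟩
    rw [← hval c]
    change encode T pt k i _ _ _ = _
    rw [encode, if_neg hki]
    have h := hsol (fun p => y' (p.1, Function.update c.1.1.2 k p.2)) (c.1.1.1, c.1.1.2 k) c.2
    simp only [Function.update_eq_self] at h
    rw [← h]
    refine Finset.sum_congr rfl fun p _ => ?_
    congr 1
    rw [extendSymbols, dif_pos]
    · simp
    · simpa [Function.update_of_ne (Ne.symm hki)] using c.1.2

theorem exists_perm_encode_eq {T : ℕ} [Finite F] (hTN : T ≤ N) {pt : Fin N × Fin N → F}
    (hpt : Function.Injective pt) (k k' i : Fin K) {s : Finset (Fin N)} (hs : s.card = T) :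
    ∃ P : Equiv.Perm (SymbolIndex K N T i → F), ∀ x, ∀ n ∈ s, ∀ σ,
      encode T pt k' i (P x) n σ = encode T pt k i x n σ := by
  obtain ⟨P, hP⟩ := exists_perm_comp_eq_of_surjective _ _
    (encodeHom_surjective (T := T) hTN hpt k i hs) (encodeHom_surjective hTN hpt k' i hs)
  refine ⟨P, fun x n hn σ => ?_⟩
  by_cases h : T ≤ (σ i).val
  · exact congrFun (hP x) ⟨⟨(n, σ), h⟩, hn⟩
  · rw [encode_eq_zero _ _ _ _ _ (not_le.1 h), encode_eq_zero _ _ _ _ _ (not_le.1 h)]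

/-- The interference in a slot is determined by the slots without desired symbols. -/
theorem sum_encode_sub {T : ℕ} {pt : Fin N × Fin N → F} (hpt : Function.Injective pt) (k : Fin K)
    (x : ∀ i, SymbolIndex K N T i → F) (c : SymbolIndex K N T k) :
    (∑ i, encode T pt k i (x i) c.1.1 c.1.2) - ∑ p ∈ systematicPositions N T,
      codeCoeff T pt (c.1.1, c.1.2 k) p *
        ∑ i, encode T pt k i (x i) p.1 (Function.update c.1.2 k p.2) = x k c := by
  obtain ⟨⟨n, σ⟩, hc⟩ := c
  simp only [Finset.mul_sum]
  rw [Finset.sum_comm, ← Finset.sum_sub_distrib, Finset.sum_eq_single k]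
  · rw [Finset.sum_eq_zero, sub_zero, encode, if_pos rfl, extendSymbols, dif_pos hc]
    -- A systematic position sets coordinate `k` below `T`, where the desired message has no symbol.
    intro p hp
    rw [encode_eq_zero, mul_zero]
    simpa [systematicPositions] using hp
  · intro i _ hik
    rw [sub_eq_zero, encode, if_neg (Ne.symm hik)]
    refine Finset.sum_congr rfl fun p hp => ?_
    rw [encode, if_neg (Ne.symm hik)]
    congr 1
    have := sum_codeCoeff_of_mem hpt hp fun p' => extendSymbols (x i) (p'.1, Function.update σ k p'.2)
    simpa using this.symm
  · simp

theorem card_filter_le_apply (i : Fin K) {T : ℕ} (hTN : T ≤ N) :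
    (Finset.univ.filter fun σ : Fin K → Fin N => T ≤ (σ i).val).card =
      (N - T) * N ^ (K - 1) := by
  classical
  have h1 : (Finset.univ.filter fun σ : Fin K → Fin N => T ≤ (σ i).val) = Fintype.piFinset
      fun j => if j = i then Finset.univ.filter fun a : Fin N => T ≤ a.val else Finset.univ := by
    ext σ
    simp only [Finset.mem_filter, Finset.mem_univ, true_and, Fintype.mem_piFinset]
    refine ⟨fun h j => ?_, fun h => by simpa using h i⟩
    split_ifs with hj
    · simpa [hj] using h
    · simp
  have h2 : (Finset.univ.filter fun a : Fin N => T ≤ a.val).card = N - T := by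
    have := Finset.card_filter_add_card_filter_not (s := (Finset.univ : Finset (Fin N)))
      (fun a => a.val < T)
    rw [card_filter_val_lt hTN] at this
    simp only [not_lt, Finset.card_univ, Fintype.card_fin] at this
    omega
  rw [h1, Fintype.card_piFinset, ← Finset.mul_prod_erase _ _ (Finset.mem_univ i), if_pos rfl, h2]
  congr 1
  rw [Finset.prod_congr rfl fun j hj => by rw [if_neg (Finset.ne_of_mem_erase hj)]]
  simp

theorem card_symbolIndex (i : Fin K) {T : ℕ} (hTN : T ≤ N) :
    Nat.card (SymbolIndex K N T i) = N * ((N - T) * N ^ (K - 1)) := by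
  have e : SymbolIndex K N T i ≃ Fin N × {σ : Fin K → Fin N // T ≤ (σ i).val} :=
    { toFun := fun c => (c.1.1, ⟨c.1.2, c.2⟩)
      invFun := fun c => ⟨(c.1, c.2.1), c.2.2⟩
      left_inv := fun _ => rfl
      right_inv := fun _ => rfl }
  rw [Nat.card_congr e, Nat.card_prod, Nat.card_eq_fintype_card, Nat.card_eq_fintype_card,
    Fintype.card_fin, Fintype.card_subtype, card_filter_le_apply i hTN]

/-- The slots in which some message has a symbol. -/
abbrev Slot (K N T : ℕ) : Type := {σ : Fin K → Fin N // ∃ i, T ≤ (σ i).val}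

theorem card_slot {T : ℕ} (hTN : T ≤ N) : Nat.card (Slot K N T) = N ^ K - T ^ K := by
  classical
  have h1 : (Finset.univ.filter fun σ : Fin K → Fin N => ¬ ∃ i, T ≤ (σ i).val) = Fintype.piFinset
      fun _ => Finset.univ.filter fun a : Fin N => a.val < T := by
    ext σ
    simp
  have h2 := Finset.card_filter_add_card_filter_not (s := (Finset.univ : Finset (Fin K → Fin N)))
      (fun σ => ∃ i, T ≤ (σ i).val)
  rw [h1, Fintype.card_piFinset] at h2
  simp only [card_filter_val_lt hTN, Finset.prod_const, Finset.card_univ, Fintype.card_fin,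
    Fintype.card_pi] at h2
  rw [Nat.card_eq_fintype_card, Fintype.card_subtype]
  omega

end Code

/-! ### Schemes built from finite data -/

/-- Entropy is at most the logarithm of the size of the alphabet. -/
theorem entropy_le_log_card {Ω S : Type} [MeasurableSpace Ω] [Finite S]
    [MeasurableSpace S] [MeasurableSingletonClass S] (μ : Measure Ω)
    [IsProbabilityMeasure μ] {X : Ω → S} (hX : Measurable X) :
    entropy μ X ≤ ENNReal.ofReal (Real.log (Nat.card S) / Real.log 2) := by
  have := Fintype.ofFinite S
  have hsum := sum_real_preimage_singleton μ hX
  set p : S → ℝ := fun s => μ.real (X ⁻¹' {s}) with hp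
  have hne : Nonempty S := by
    by_contra h
    rw [not_nonempty_iff] at h
    simp at hsum
  have hc : (0 : ℝ) < Nat.card S := by exact_mod_cast Nat.card_pos
  set M : ℝ := ((Nat.card S : ℕ) : ℝ) with hM
  have hterm : ∀ s, M * Real.negMulLog (p s) ≤ 1 - p s * M + p s * M * Real.log M := by
    intro s
    have h := negMulLog_le_one_sub (mul_nonneg (measureReal_nonneg : 0 ≤ p s) hc.le)
    rw [Real.negMulLog_mul] at h
    simp only [Real.negMulLog] at h ⊢
    linarith
  have hall := Finset.sum_le_sum fun s (_ : s ∈ Finset.univ) => hterm s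
  simp only [Finset.sum_add_distrib, Finset.sum_sub_distrib, ← Finset.mul_sum, ← Finset.sum_mul,
    hsum] at hall
  have hcard : (∑ _s : S, (1 : ℝ)) = M := by simp [hM, Nat.card_eq_fintype_card]
  rw [hcard] at hall
  rw [entropy_eq_ofReal_sum]
  refine ENNReal.ofReal_le_ofReal (div_le_div_of_nonneg_right ?_ (Real.log_nonneg (by norm_num)))
  refine le_of_mul_le_mul_left ?_ hc
  linarith

/-- The uniform law on a finite type. -/
noncomputable def uniformLaw (α : Type) [Fintype α] [Nonempty α] [MeasurableSpace α] : Measure α :=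
  (PMF.uniformOfFintype α).toMeasure

section UniformLaw

variable {α : Type} [Fintype α] [Nonempty α] [MeasurableSpace α]

instance : IsProbabilityMeasure (uniformLaw α) := by
  unfold uniformLaw
  infer_instance

theorem uniformLaw_singleton [MeasurableSingletonClass α] (a : α) :
    uniformLaw α {a} = (Fintype.card α : ℝ≥0∞)⁻¹ := by
  rw [uniformLaw, PMF.toMeasure_apply_singleton _ _ (measurableSet_singleton a),
    PMF.uniformOfFintype_apply]

theorem map_perm_uniformLaw [DiscreteMeasurableSpace α] (e : Equiv.Perm α) :
    (uniformLaw α).map e = uniformLaw α := by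
  refine Measure.ext_of_singleton fun a => ?_
  rw [Measure.map_apply (Measurable.of_discrete) (measurableSet_singleton a)]
  have : e ⁻¹' {a} = {e.symm a} := by
    ext b
    simp [Equiv.eq_symm_apply]
  rw [this, uniformLaw_singleton, uniformLaw_singleton]

end UniformLaw

namespace Scheme

section OfFinite

/-- The joint law of uniform messages and independent uniform randomness of the user. -/
noncomputable def jointLaw (K L : ℕ) (R : Type) [Fintype R] [Nonempty R] [MeasurableSpace R] :
    Measure (Messages K L × R) :=
  (Measure.pi fun _ : Fin K => uniformLaw (Fin L → Bool)).prod (uniformLaw R)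

instance {K L : ℕ} (R : Type) [Fintype R] [Nonempty R] [MeasurableSpace R] :
    IsProbabilityMeasure (jointLaw K L R) := by
  unfold jointLaw
  infer_instance

theorem map_message_jointLaw {K : ℕ} (L : ℕ) (R : Type) [Fintype R] [Nonempty R]
    [MeasurableSpace R] (k : Fin K) :
    (jointLaw K L R).map (fun ω => ω.1 k) = uniformLaw (Fin L → Bool) := by
  have : (fun ω : Messages K L × R => ω.1 k) = Function.eval k ∘ Prod.fst := rfl
  rw [this, ← Measure.map_map (measurable_pi_apply k) measurable_fst, jointLaw,
    Measure.map_fst_prod, measure_univ, one_smul, Measure.pi_map_eval]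
  simp

variable {K N T : ℕ} (L : ℕ) (hL : 0 < L) (R Query Answer : Type) [Fintype R] [Nonempty R]
  [MeasurableSpace R] [DiscreteMeasurableSpace R]
  [Finite Query] [MeasurableSpace Query] [DiscreteMeasurableSpace Query]
  [Finite Answer] [MeasurableSpace Answer] [DiscreteMeasurableSpace Answer]
  (Q : Fin K → R → Fin N → Query) (answer : Fin N → Query → Messages K L → Answer)
  (decode : Fin K → (Fin N → Answer) → (Fin N → Query) → (Fin L → Bool))
  (correct : ∀ k r w, decode k (fun n => answer n (Q k r n) w) (Q k r) = w k)
  (privacy : ∀ s : Finset (Fin N), s.card = T → ∀ k k' : Fin K,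
    ∃ e : Equiv.Perm R, ∀ r, ∀ n ∈ s, Q k' (e r) n = Q k r n)

/-- A scheme from finite data: uniform messages and uniform randomness of the user. -/
noncomputable def ofFinite : Scheme K N T where
  L := L
  L_pos := hL
  Ω := Messages K L × R
  μ := jointLaw K L R
  W k ω := ω.1 k
  measurable_W k := (measurable_pi_apply k).comp measurable_fst
  indep_W := by
    have hm : ∀ k, AEMeasurable (fun ω : Messages K L × R => ω.1 k) (jointLaw K L R) :=
      fun k => ((measurable_pi_apply k).comp measurable_fst).aemeasurable
    refine (iIndepFun_iff_map_fun_eq_pi_map hm).2 ?_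
    simp only [map_message_jointLaw]
    change (jointLaw K L R).map Prod.fst = _
    rw [jointLaw, Measure.map_fst_prod, measure_univ, one_smul]
  entropy_W k := by
    have hlog : 0 < Real.log 2 := Real.log_pos (by norm_num)
    have h : ∀ s, (jointLaw K L R).real ((fun ω => ω.1 k) ⁻¹' {s}) = ((2 : ℝ) ^ L)⁻¹ := by
      intro s
      have : (jointLaw K L R).map (fun ω => ω.1 k) {s} = uniformLaw (Fin L → Bool) {s} := by
        rw [map_message_jointLaw]
      have hm : Measurable fun ω : Messages K L × R => ω.1 k :=
        (measurable_pi_apply k).comp measurable_fst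
      rw [Measure.map_apply hm (measurableSet_singleton s), uniformLaw_singleton] at this
      rw [Measure.real, this]
      simp
    rw [entropy_eq_ofReal_sum]
    simp only [h]
    rw [← ENNReal.ofReal_natCast]
    congr 1
    simp [Real.negMulLog]
    field_simp
  Query := Query
  Q k ω := Q k ω.2
  measurable_Q k := (Measurable.of_discrete (f := Q k)).comp measurable_snd
  indep_Q k := indepFun_prod (X := id) measurable_id (Measurable.of_discrete (f := Q k))
  Answer := Answer
  answer := answer
  measurable_answer n := Measurable.of_discrete
  decode := decode
  measurable_decode k := Measurable.of_discrete
  correct k := Filter.Eventually.of_forall fun ω => correct k ω.2 ω.1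
  privacy s hs k k' := by
    have hm : ∀ k, Measurable fun (r : R) (n : s) => Q k r n := fun k => Measurable.of_discrete
    refine ⟨((hm k).comp measurable_snd).aemeasurable, ((hm k').comp measurable_snd).aemeasurable, ?_⟩
    obtain ⟨e, he⟩ := privacy s hs k k'
    have hsnd : (jointLaw K L R).map Prod.snd = uniformLaw R := by
      rw [jointLaw, Measure.map_snd_prod, measure_univ, one_smul]
    have h1 : (fun (r : R) (n : s) => Q k r n) = (fun (r : R) (n : s) => Q k' r n) ∘ e :=
      funext fun r => funext fun n => (he r n n.2).symm
    change (jointLaw K L R).map ((fun (r : R) (n : s) => Q k r n) ∘ Prod.snd) =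
      (jointLaw K L R).map ((fun (r : R) (n : s) => Q k' r n) ∘ Prod.snd)
    rw [← Measure.map_map (hm k) measurable_snd, ← Measure.map_map (hm k') measurable_snd, hsnd,
      h1, ← Measure.map_map (hm k') Measurable.of_discrete, map_perm_uniformLaw]

end OfFinite

theorem download_le_of_finite {K N T : ℕ} (S : Scheme K N T) [Finite S.Answer] (k : Fin K) :
    S.download k ≤ ENNReal.ofReal (N * (Real.log (Nat.card S.Answer) / Real.log 2)) := by
  have hA : ∀ n, Measurable (S.A k n) := fun n => (S.measurable_answer n).comp
    (((measurable_pi_apply n).comp (S.measurable_Q k)).prodMk S.measurable_messages)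
  refine (Finset.sum_le_sum fun n _ => entropy_le_log_card S.μ (hA n)).trans (le_of_eq ?_)
  rw [Finset.sum_const, Finset.card_univ, Fintype.card_fin, nsmul_eq_mul,
    ENNReal.ofReal_mul (Nat.cast_nonneg N), ENNReal.ofReal_natCast]

/-- A scheme whose answers have a small alphabet bounds the capacity from below. -/
theorem le_capacity_of_finite {K N T : ℕ} (S : Scheme K N T) [Finite S.Answer] {c : ℝ}
    (hc : 0 < c) (h : N * (Real.log (Nat.card S.Answer) / Real.log 2) ≤ S.L / c) :
    ENNReal.ofReal c ≤ capacity K N T := by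
  refine le_trans ?_ (le_iSup (fun S : Scheme K N T => S.rate) S)
  have hL : (0 : ℝ) < S.L := by exact_mod_cast S.L_pos
  calc ENNReal.ofReal c = S.L / ENNReal.ofReal (S.L / c) := by
        rw [← ENNReal.ofReal_natCast, ← ENNReal.ofReal_div_of_pos (by positivity)]
        congr 1
        field_simp
    _ ≤ S.rate := ENNReal.div_le_div_left
        (iSup_le fun k => (S.download_le_of_finite k).trans (ENNReal.ofReal_le_ofReal h)) _

end Scheme

/-! ### The coded scheme -/

section ReedSolomonScheme

variable (F : Type) (K N T L : ℕ)

/-- The randomness of the user: a bijection between the message strings and the vectors of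
symbols, for each message. -/
def Randomness : Type := ∀ i : Fin K, (Fin L → Bool) ≃ (SymbolIndex K N T i → F)

/-- A query assigns to each message and each slot a symbol-valued function of the message. -/
def SlotQuery : Type := Fin K → (Fin L → Bool) → (Fin K → Fin N) → F

/-- An answer consists of one symbol for each slot. -/
def SlotAnswer : Type := Slot K N T → F

instance [Finite F] : Finite (Randomness F K N T L) := by
  unfold Randomness
  infer_instance

instance [Finite F] : Finite (SlotQuery F K N L) := by
  unfold SlotQuery
  infer_instance

instance [Finite F] : Finite (SlotAnswer F K N T) := by
  unfold SlotAnswer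
  infer_instance

instance : MeasurableSpace (Randomness F K N T L) := ⊤

instance : MeasurableSpace (SlotQuery F K N L) := ⊤

instance : MeasurableSpace (SlotAnswer F K N T) := ⊤

instance : DiscreteMeasurableSpace (Randomness F K N T L) := ⟨fun _ => trivial⟩

instance : DiscreteMeasurableSpace (SlotQuery F K N L) := ⟨fun _ => trivial⟩

instance : DiscreteMeasurableSpace (SlotAnswer F K N T) := ⟨fun _ => trivial⟩

theorem nonempty_randomness [Finite F] {m : ℕ} (hF : Nat.card F = 2 ^ m) (hTN : T ≤ N) :
    Nonempty (Randomness F K N T (m * (N * ((N - T) * N ^ (K - 1))))) := by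
  refine ⟨fun i => (Finite.equivFinOfCardEq ?_).trans (Finite.equivFin _).symm⟩
  rw [Nat.card_fun, Nat.card_fun, card_symbolIndex i hTN, hF, ← pow_mul]
  simp

variable {F K N T L} [Field F]

/-- The query to database `n` when message `k` is desired. -/
noncomputable def slotQuery (pt : Fin N × Fin N → F) (k : Fin K) (r : Randomness F K N T L)
    (n : Fin N) : SlotQuery F K N L :=
  fun i w σ => encode T pt k i (r i w) n σ

/-- The databases add up the contributions of the messages in each slot. -/
def slotAnswer (q : SlotQuery F K N L) (w : Messages K L) : SlotAnswer F K N T :=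
  fun σ => ∑ i, q i (w i) σ.1

open Classical in
/-- The answers, extended by zero to all slots. -/
noncomputable def extendAnswer (a : Fin N → SlotAnswer F K N T) (n : Fin N)
    (σ : Fin K → Fin N) : F :=
  if h : ∃ i, T ≤ (σ i).val then a n ⟨σ, h⟩ else 0

/-- The user subtracts the interference and inverts the bijection of the desired message. -/
noncomputable def slotDecode (pt : Fin N × Fin N → F) (k : Fin K)
    (a : Fin N → SlotAnswer F K N T) (q : Fin N → SlotQuery F K N L) : Fin L → Bool :=
  Function.invFun (fun v (c : SymbolIndex K N T k) => q c.1.1 k v c.1.2) fun c =>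
    extendAnswer a c.1.1 c.1.2 - ∑ p ∈ systematicPositions N T,
      codeCoeff T pt (c.1.1, c.1.2 k) p * extendAnswer a p.1 (Function.update c.1.2 k p.2)

theorem extendAnswer_slotAnswer (pt : Fin N × Fin N → F) (k : Fin K) (r : Randomness F K N T L)
    (w : Messages K L) (n : Fin N) (σ : Fin K → Fin N) :
    extendAnswer (fun n => slotAnswer (T := T) (slotQuery pt k r n) w) n σ =
      ∑ i, encode T pt k i (r i (w i)) n σ := by
  unfold extendAnswer
  split_ifs with h
  · rfl
  · push Not at h
    exact (Finset.sum_eq_zero fun i _ => encode_eq_zero _ _ _ _ _ (h i)).symm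

theorem slotDecode_eq {pt : Fin N × Fin N → F} (hpt : Function.Injective pt) (k : Fin K)
    (r : Randomness F K N T L) (w : Messages K L) :
    slotDecode pt k (fun n => slotAnswer (T := T) (slotQuery pt k r n) w) (slotQuery pt k r) =
      w k := by
  have h1 : (fun v (c : SymbolIndex K N T k) => slotQuery pt k r c.1.1 k v c.1.2) = r k := by
    funext v c
    simp only [slotQuery, encode, if_true, extendSymbols]
    exact dif_pos c.2
  unfold slotDecode
  simp only [extendAnswer_slotAnswer]
  rw [h1]
  simp only [sum_encode_sub hpt k (fun i => r i (w i))]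
  exact Function.leftInverse_invFun (r k).injective (w k)

/-- Composing the random bijection of each message with the permutation from `exists_perm_encode_eq`
permutes the randomness, and turns queries for `k` into queries for `k'` as seen by `s`. -/
theorem exists_perm_slotQuery_eq [Finite F] (hTN : T ≤ N) {pt : Fin N × Fin N → F}
    (hpt : Function.Injective pt) {s : Finset (Fin N)} (hs : s.card = T) (k k' : Fin K) :
    ∃ e : Equiv.Perm (Randomness F K N T L), ∀ r, ∀ n ∈ s,
      slotQuery pt k' (e r) n = slotQuery pt k r n := by
  choose P hP using fun i => exists_perm_encode_eq hTN hpt k k' i hs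
  refine ⟨Equiv.piCongrRight fun i => Equiv.equivCongr (Equiv.refl _) (P i), fun r n hn => ?_⟩
  funext i w σ
  exact hP i (r i w) n hn σ

end ReedSolomonScheme

/-- The capacity is attained by a coded scheme if not all databases collude. -/
theorem le_capacity_of_lt {K N T : ℕ} (hK : 1 ≤ K) (hTN : T < N) :
    ENNReal.ofReal ((∑ i ∈ Finset.range K, (T : ℝ) ^ i / (N : ℝ) ^ i)⁻¹) ≤ capacity K N T := by
  -- A field of `2 ^ m` elements has room for `N * N` distinct evaluation points, and a symbol is
  -- worth exactly `m` bits.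
  set m := N * N + 1 with hm
  have : Fact (Nat.Prime 2) := ⟨Nat.prime_two⟩
  have hF : Nat.card (GaloisField 2 m) = 2 ^ m := GaloisField.card 2 m (by omega)
  have hfin : Finite (GaloisField 2 m) := Nat.finite_of_card_ne_zero (by rw [hF]; positivity)
  have := Fintype.ofFinite (GaloisField 2 m)
  obtain ⟨pt⟩ : Nonempty (Fin N × Fin N ↪ GaloisField 2 m) := by
    refine Function.Embedding.nonempty_of_card_le ?_
    rw [← Nat.card_eq_fintype_card (α := GaloisField 2 m), hF, Fintype.card_prod, Fintype.card_fin]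
    exact (Nat.le_succ _).trans Nat.lt_two_pow_self.le
  set L := m * (N * ((N - T) * N ^ (K - 1))) with hL
  have hsub : 0 < N - T := by omega
  have hN : 0 < N := by omega
  have hLpos : 0 < L := by positivity
  have := nonempty_randomness (GaloisField 2 m) K N T hF hTN.le
  have := Fintype.ofFinite (Randomness (GaloisField 2 m) K N T L)
  let S : Scheme K N T := Scheme.ofFinite L hLpos (Randomness (GaloisField 2 m) K N T L)
    (SlotQuery (GaloisField 2 m) K N L) (SlotAnswer (GaloisField 2 m) K N T) (slotQuery pt)
    (fun _ => slotAnswer) (slotDecode pt) (slotDecode_eq pt.injective)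
    fun s hs k k' => exists_perm_slotQuery_eq hTN.le pt.injective hs k k'
  have : Finite S.Answer := inferInstanceAs (Finite (SlotAnswer (GaloisField 2 m) K N T))
  have hcard : Nat.card S.Answer = 2 ^ (m * (N ^ K - T ^ K)) := by
    change Nat.card (Slot K N T → GaloisField 2 m) = _
    rw [Nat.card_fun, hF, card_slot hTN.le, ← pow_mul]
  have hNR : (0 : ℝ) < N := by exact_mod_cast hN
  have hG : 0 < ∑ i ∈ Finset.range K, (T : ℝ) ^ i / (N : ℝ) ^ i :=
    Finset.sum_pos' (fun i _ => by positivity) ⟨0, Finset.mem_range.2 hK, by simp⟩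
  refine S.le_capacity_of_finite (inv_pos.2 hG) (le_of_eq ?_)
  have hlog : Real.log 2 ≠ 0 := (Real.log_pos (by norm_num)).ne'
  have hgeom := geom_sum_mul ((T : ℝ) / N) K
  simp only [div_pow] at hgeom
  set G := ∑ i ∈ Finset.range K, (T : ℝ) ^ i / (N : ℝ) ^ i
  -- The geometric sum cleared of denominators: it makes the download bound equal to `G` times the
  -- message size.
  have hgeom' : G * ((N - T) * (N : ℝ) ^ (K - 1)) = (N : ℝ) ^ K - (T : ℝ) ^ K := by
    obtain ⟨K, rfl⟩ : ∃ K', K = K' + 1 := ⟨K - 1, by omega⟩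
    have : (T : ℝ) / N - 1 = -((N - T) / N) := by field_simp; ring
    rw [this] at hgeom
    field_simp at hgeom
    rw [Nat.add_sub_cancel]
    refine mul_left_cancel₀ hNR.ne' ?_
    linear_combination -hgeom
  have hSL : (S.L : ℝ) = m * (N * ((N - T) * (N : ℝ) ^ (K - 1))) := by
    change (L : ℝ) = _
    rw [hL]
    push_cast [hTN.le]
    ring
  rw [hcard, hSL, div_inv_eq_mul, Nat.cast_pow, Real.log_pow, Nat.cast_ofNat,
    mul_div_cancel_right₀ _ hlog, Nat.cast_mul, Nat.cast_sub (Nat.pow_le_pow_left hTN.le K),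
    Nat.cast_pow, Nat.cast_pow, ← hgeom']
  ring

/-- If all databases collude, then downloading all the messages attains the capacity. -/
theorem le_capacity_self {K N : ℕ} (hK : 1 ≤ K) (hN : 1 ≤ N) :
    ENNReal.ofReal ((∑ i ∈ Finset.range K, (N : ℝ) ^ i / (N : ℝ) ^ i)⁻¹) ≤ capacity K N N := by
  -- Messages have `N` bits, the query is trivial, and database `n` returns bit `n` of every
  -- message.
  let S : Scheme K N N := Scheme.ofFinite N hN Unit Unit (Fin K → Bool) (fun _ _ _ => ())
    (fun n _ w i => w i n) (fun k a _ n => a n k) (fun _ _ _ => rfl)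
    fun _ _ _ _ => ⟨Equiv.refl _, fun _ _ _ => rfl⟩
  have : Finite S.Answer := inferInstanceAs (Finite (Fin K → Bool))
  have hcard : Nat.card S.Answer = 2 ^ K := by
    change Nat.card (Fin K → Bool) = _
    simp
  have hNR : (N : ℝ) ≠ 0 := by positivity
  have hKR : (0 : ℝ) < K := by exact_mod_cast hK
  have hlog : Real.log 2 ≠ 0 := (Real.log_pos (by norm_num)).ne'
  have hsum : ∑ i ∈ Finset.range K, (N : ℝ) ^ i / (N : ℝ) ^ i = K := by simp [hNR]
  rw [hsum]
  refine S.le_capacity_of_finite (inv_pos.2 hKR) (le_of_eq ?_)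
  rw [hcard, Nat.cast_pow, Real.log_pow, Nat.cast_ofNat, mul_div_cancel_right₀ _ hlog,
    div_inv_eq_mul]
  rfl

end PIR

theorem theorem1 (K N T : ℕ) (hK : 1 ≤ K) (hT : 1 ≤ T) (hTN : T ≤ N) :
    PIR.capacity K N T =
      ENNReal.ofReal ((∑ i ∈ Finset.range K, (T : ℝ) ^ i / (N : ℝ) ^ i)⁻¹) := by
  refine le_antisymm (iSup_le fun S => S.rate_le hK hT hTN) ?_
  rcases hTN.lt_or_eq with h | rfl
  · exact PIR.le_capacity_of_lt hK h
  · exact PIR.le_capacity_self hK hT
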